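/- Let $\mathbb H$ be the skew field of real quaternions, $n\ge 1$, and let $M^*$ denote the conjugate transpose of a quaternion matrix $M$. For $M=(m_{ij})\in\mathbb H^{n\times n}$ and an index $i$, write every $\sigma\in S_n$ as a product of $r$ disjoint cycles, fixed points included as cycles of length one, so that $i$ opens the first cycle, each other cycle is opened by its smallest element, and these smallest elements increase from the second cycle to the $r$-th. A cycle opened by $x$ contributes the factor $m_{x\,\sigma(x)}\,m_{\sigma(x)\,\sigma^2(x)}\cdots m_{\sigma^{l}(x)\,x}$, where $l+1$ is its length; let $P_t(\sigma)$ be the factor of the $t$-th cycle. The $i$th row determinant and the $i$th column determinant of $M$ are $$\operatorname{rdet}_i M=\sum_{\sigma\in S_n}(-1)^{n-r}P_1(\sigma)P_2(\sigma)\cdots P_r(\sigma),\qquad \operatorname{cdet}_i M=\sum_{\sigma\in S_n}(-1)^{n-r}P_r(\sigma)\cdots P_2(\sigma)P_1(\sigma).$$ For a Hermitian matrix $M$ all the row and column determinants coincide and are real; their common value is $\det M$ (so $\det M=\operatorname{rdet}_1 M$). The double determinant of $A\in\mathbb H^{n\times n}$ is $\operatorname{ddet}A=\det(A^*A)$. Write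 $M_{j.}(v)$ (respectively $M_{.i}(v)$) for the matrix obtained from $M$ by replacing its $j$th row (respectively $i$th column) by $v$. **Theorem.** Let $A,B,C\in\mathbb H^{n\times n}$ with $\operatorname{ddet}A\neq 0$ and $\operatorname{ddet}B\neq 0$. Put $\tilde C=A^*CB^*$, with rows $\tilde c_{k.}$ and columns $\tilde c_{.m}$, and for $1\le i,j\le n$ let $$c^A_{i.}=\bigl(\operatorname{cdet}_i\,(A^*A)_{.i}(\tilde c_{.1}),\ \dots,\ \operatorname{cdet}_i\,(A^*A)_{.i}(\tilde c_{.n})\bigr)$$ (a row vector) and $$c^B_{.j}=\bigl(\operatorname{rdet}_j\,(BB^*)_{j.}(\tilde c_{1.}),\ \dots,\ \operatorname{rdet}_j\,(BB^*)_{j.}(\tilde c_{n.})\bigr)^T$$ (a column vector). Then the equation $AXB=C$ has a unique solution $X=(x_{ij})\in\mathbb H^{n\times n}$, and for all $i,j=1,\dots,n$ $$x_{ij}=\frac{\operatorname{rdet}_j\,(BB^*)_{j.}\bigl(c^A_{i.}\bigr)}{\operatorname{ddet}A\cdot\operatorname{ddet}B}\qquad\text{and also}\qquad x_{ij}=\frac{\operatorname{cdet}_i\,(A^*A)_{.i}\bigl(c^B_{.j}\bigr)}{\operatorname{ddet}A\cdot\operatorname{ddet}B}.$$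 -/

import Mathlib

open scoped Matrix Quaternion

namespace QuatDet

variable {R : Type*} {n : ℕ}

/-- The product of the entries of `A` along the cycle of `σ` through `x`, read from `x`:
if that cycle is `(x x₁ … x_l)`, i.e. `σ x = x₁`, …, `σ x_l = x`, the product is
`a_{x x₁} * a_{x₁ x₂} * ⋯ * a_{x_l x}`. A fixed point `x` gives `a_{x x}`. -/
noncomputable def cycleProd [Ring R] (A : Matrix (Fin n) (Fin n) R)
    (σ : Equiv.Perm (Fin n)) (x : Fin n) : R :=
  ((List.range (Function.minimalPeriod σ x)).map
    fun t => A ((σ ^ t) x) ((σ ^ (t + 1)) x)).prod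

open Classical in
/-- The smallest elements of the cycles of `σ` (fixed points count as cycles of length one) that
do not contain `i`, in increasing order: the indices opening the second, third, …, `r`-th cycle
in the ordered cycle notation of `σ` whose first cycle is opened by `i`. -/
noncomputable def cycleLeaders (σ : Equiv.Perm (Fin n)) (i : Fin n) : List (Fin n) :=
  (List.finRange n).filter fun x => ¬ σ.SameCycle i x ∧ ∀ y, σ.SameCycle x y → x ≤ y

/-- The number `r` of cycles of `σ`, fixed points included: the cycle of `i` and all the others. -/
noncomputable def cycleCount (σ : Equiv.Perm (Fin n)) (i : Fin n) : ℕ :=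
  (cycleLeaders σ i).length + 1

/-- The `i`-th row determinant: the monomial of `σ` is the product of its cycles, the cycle
opened by `i` first (leftmost), then the others, each opened by its smallest element, these
elements increasing from left to right. -/
noncomputable def rdet [Ring R] (i : Fin n) (A : Matrix (Fin n) (Fin n) R) : R :=
  ∑ σ : Equiv.Perm (Fin n), (-1) ^ (n - cycleCount σ i) *
    (cycleProd A σ i * ((cycleLeaders σ i).map (cycleProd A σ)).prod)

/-- The `j`-th column determinant: the monomial of `τ` is the product of its cycles, the cycle
opened by `j` last (rightmost), the others, each opened (from the right) by its smallest
element, these elements increasing from right to left. A right-ordered cycle `(x_l … x₁ x)`,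
i.e. `τ x = x_l`, …, `τ x₁ = x`, contributes `a_{x x_l} * ⋯ * a_{x₂ x₁} * a_{x₁ x}`. -/
noncomputable def cdet [Ring R] (j : Fin n) (A : Matrix (Fin n) (Fin n) R) : R :=
  ∑ τ : Equiv.Perm (Fin n), (-1) ^ (n - cycleCount τ j) *
    (((cycleLeaders τ j).reverse.map (cycleProd A τ)).prod * cycleProd A τ j)

/-- The determinant of a Hermitian matrix. All row and column determinants of a Hermitian
quaternion matrix have the same (real) value; the first row determinant is taken. -/
noncomputable def hermDet [Ring R] [NeZero n] (M : Matrix (Fin n) (Fin n) R) : R :=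
  rdet 0 M

/-- The double determinant `ddet A = det (A* A)`. -/
noncomputable def ddet [Ring R] [StarRing R] [NeZero n] (A : Matrix (Fin n) (Fin n) R) : R :=
  hermDet (Aᴴ * A)

/-- `C̃ = A* C B*`. -/
def cTilde [Ring R] [StarRing R] (A B C : Matrix (Fin n) (Fin n) R) :
    Matrix (Fin n) (Fin n) R :=
  Aᴴ * C * Bᴴ

/-- The row vector `c^A_{i.}`: its `m`-th entry is `cdet_i` of `A* A` with the `i`-th column
replaced by the `m`-th column of `C̃`. -/
noncomputable def cA [Ring R] [StarRing R] (A B C : Matrix (Fin n) (Fin n) R) (i : Fin n) :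
    Fin n → R :=
  fun m => cdet i ((Aᴴ * A).updateCol i (fun k => cTilde A B C k m))

/-- The column vector `c^B_{.j}`: its `k`-th entry is `rdet_j` of `B B*` with the `j`-th row
replaced by the `k`-th row of `C̃`. -/
noncomputable def cB [Ring R] [StarRing R] (A B C : Matrix (Fin n) (Fin n) R) (j : Fin n) :
    Fin n → R :=
  fun k => rdet j ((B * Bᴴ).updateRow j (fun m => cTilde A B C k m))

end QuatDet

/-! Let D(T) be the determinant of the principal submatrix on T (`principalDet`) and S(U; a, b) the
signed sum over all paths from a to b that visit each point of U once (`pathSum`). Peeling entries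
off the cycle of j turns rdet_j into the subset convolution of S(·; j, j) and D on the indices other
than j (`pathDet_eq_conv`). Hence rdet_j is left-linear in row j, with explicit cofactors
(`rdet_updateRow`).

For Hermitian M, reversing a path conjugates its product, so closed path sums are real, hence
central; since Re(pq) = Re(qp), they do not depend on the base point. Therefore D expands along any
index (`principalDet_insert`), and an expansion with the wrong row vanishes. When det M ≠ 0, the
transposed cofactor matrix is thus M⁻¹ det M, which is Cramer's rule for rdet; conjugation gives it
for cdet.

Applied twice to X = (A*A)⁻¹ C̃ (BB*)⁻¹, this gives both formulas with denominator det(A*A)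
det(BB*). Since ddet B is det(B*B), it remains to see det(BB*) = det(B*B). The determinant of the
real 4n × 4n representation is multiplicative, and Schur complements show that on positive definite
matrices det is positive with fourth power this real determinant. -/

namespace QuatDet

open Equiv Finset

/-! ### Peeling a point off a cycle -/

section Permutations

variable {R : Type*} {n : ℕ}

/-- The permutations of `Fin n` that fix every point outside `T`. -/
def permsOn (T : Finset (Fin n)) : Finset (Perm (Fin n)) :=
  univ.filter fun σ => ∀ y, y ∉ T → σ y = y

theorem mem_permsOn {T : Finset (Fin n)} {σ : Perm (Fin n)} :
    σ ∈ permsOn T ↔ ∀ y, y ∉ T → σ y = y := by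
  simp [permsOn]

open Classical in
/-- The smallest elements of the cycles of `σ`, as far as they lie in `T`. -/
noncomputable def leaders (T : Finset (Fin n)) (σ : Perm (Fin n)) : List (Fin n) :=
  (List.finRange n).filter fun x => x ∈ T ∧ ∀ y, σ.SameCycle x y → x ≤ y

open Classical in
/-- The smallest elements of the cycles of `σ` not containing `j`, as far as they lie in `T`. -/
noncomputable def leadersOff (j : Fin n) (T : Finset (Fin n)) (σ : Perm (Fin n)) :
    List (Fin n) :=
  (List.finRange n).filter fun x =>
    x ∈ T ∧ ¬ σ.SameCycle j x ∧ ∀ y, σ.SameCycle x y → x ≤ y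

/-- The product of the entries of `A` along the cycle of `σ` through `j`, with the row of the
first factor replaced by the row `a`. -/
noncomputable def pathProd [Ring R] (A : Matrix (Fin n) (Fin n) R) (a : Fin n)
    (σ : Perm (Fin n)) (j : Fin n) : R :=
  A a (σ j) * ((List.range (Function.minimalPeriod σ j - 1)).map
    fun t => A ((σ ^ (t + 1)) j) ((σ ^ (t + 2)) j)).prod

/-- The row determinant of the principal submatrix of `A` on `T`, each cycle being opened by its
smallest element. -/
noncomputable def principalDet [Ring R] (A : Matrix (Fin n) (Fin n) R) (T : Finset (Fin n)) : R :=
  ∑ σ ∈ permsOn T, (-1) ^ #T * ((leaders T σ).map fun x => - cycleProd A σ x).prod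

/-- The `j`-th row determinant of the principal submatrix of `A` on `T ∪ {j}`, with its `j`-th row
replaced by the `a`-th row of `A`. -/
noncomputable def pathDet [Ring R] (A : Matrix (Fin n) (Fin n) R) (T : Finset (Fin n))
    (a j : Fin n) : R :=
  ∑ σ ∈ permsOn (insert j T), (-1) ^ #T *
    (pathProd A a σ j * ((leadersOff j T σ).map fun x => - cycleProd A σ x).prod)

theorem minimalPeriod_pos (σ : Perm (Fin n)) (x : Fin n) : 0 < Function.minimalPeriod σ x :=
  Function.minimalPeriod_pos_of_mem_periodicPts
    ((Function.Injective.mem_periodicPts σ.injective x))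

theorem cycleProd_eq_pathProd [Ring R] (A : Matrix (Fin n) (Fin n) R) (σ : Perm (Fin n))
    (j : Fin n) : cycleProd A σ j = pathProd A j σ j := by
  obtain ⟨p, hp⟩ := Nat.exists_eq_succ_of_ne_zero (minimalPeriod_pos σ j).ne'
  simp [cycleProd, pathProd, hp, List.range_succ_eq_map, List.map_map, Function.comp_def]

theorem pow_ne_of_fixed {σ : Perm (Fin n)} {x y : Fin n} (hx : σ x = x) (hy : y ≠ x) (k : ℕ) :
    (σ ^ k) y ≠ x := by
  intro h
  have : (σ ^ k) x = x := Equiv.Perm.pow_apply_eq_self_of_apply_eq_self hx k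
  exact hy ((σ ^ k).injective (h.trans this.symm))

theorem pow_mul_swap_of_not_sameCycle {σ : Perm (Fin n)} {j x y : Fin n} (hx : σ x = x)
    (hy : y ≠ x) (hj : ¬ σ.SameCycle j y) (k : ℕ) : ((σ * swap j x) ^ k) y = (σ ^ k) y := by
  induction k with
  | zero => rfl
  | succ k ih =>
    rw [pow_succ', Perm.mul_apply, ih, pow_succ', Perm.mul_apply, Perm.mul_apply,
      swap_apply_of_ne_of_ne _ (pow_ne_of_fixed hx hy k)]
    intro h
    exact hj (Perm.SameCycle.symm ⟨k, by simpa using h⟩)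

/-- If σ fixes x, then σ * swap j x sends j to x and x to σ j: it inserts x into the cycle of j
right after j. The orbit of j is therefore delayed by one step, up to its return to j. -/
theorem pow_mul_swap {σ : Perm (Fin n)} {j x : Fin n} (hx : σ x = x) (hj : j ≠ x) (k : ℕ)
    (hk : k < Function.minimalPeriod σ j) :
    ((σ * swap j x) ^ (k + 2)) j = (σ ^ (k + 1)) j := by
  induction k with
  | zero => simp [pow_succ, hx]
  | succ k ih =>
    rw [pow_succ', Perm.mul_apply, ih (by omega), pow_succ' σ (k + 1), Perm.mul_apply,
      Perm.mul_apply, swap_apply_of_ne_of_ne _ (pow_ne_of_fixed hx hj _)]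
    intro h
    have : Function.IsPeriodicPt σ (k + 1) j := by
      rw [Function.IsPeriodicPt, Function.IsFixedPt, Equiv.Perm.iterate_eq_pow, h]
    exact absurd (this.minimalPeriod_le (by omega)) (by omega)

theorem minimalPeriod_mul_swap {σ : Perm (Fin n)} {j x : Fin n} (hx : σ x = x) (hj : j ≠ x) :
    Function.minimalPeriod (σ * swap j x) j = Function.minimalPeriod σ j + 1 := by
  have hp := minimalPeriod_pos σ j
  have hper : Function.IsPeriodicPt (σ * swap j x) (Function.minimalPeriod σ j + 1) j := by
    rw [Function.IsPeriodicPt, Function.IsFixedPt, Equiv.Perm.iterate_eq_pow]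
    obtain ⟨p, hp'⟩ := Nat.exists_eq_succ_of_ne_zero hp.ne'
    rw [hp', pow_mul_swap hx hj p (by omega), ← Nat.succ_eq_add_one, ← hp',
      ← Equiv.Perm.iterate_eq_pow]
    exact Function.iterate_minimalPeriod
  refine le_antisymm (hper.minimalPeriod_le (by omega)) ?_
  by_contra! h
  have h0 := minimalPeriod_pos (σ * swap j x) j
  have h1 : ((σ * swap j x) ^ (Function.minimalPeriod (σ * swap j x) j)) j = j := by
    rw [← Equiv.Perm.iterate_eq_pow]; exact Function.iterate_minimalPeriod
  obtain ⟨q, hq⟩ := Nat.exists_eq_succ_of_ne_zero h0.ne'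
  rw [hq] at h1 h
  rcases q with _ | q
  · simp [hx] at h1
    exact hj h1.symm
  · rw [Nat.succ_eq_add_one, pow_mul_swap hx hj q (by omega)] at h1
    have : Function.IsPeriodicPt σ (q + 1) j := by
      rw [Function.IsPeriodicPt, Function.IsFixedPt, Equiv.Perm.iterate_eq_pow, h1]
    exact absurd (this.minimalPeriod_le (by omega)) (by omega)

theorem exists_pow_of_sameCycle {σ : Perm (Fin n)} {x y : Fin n} (h : σ.SameCycle x y) :
    ∃ k : ℕ, (σ ^ k) x = y := by
  obtain ⟨k, -, hk⟩ := h.exists_pow_eq'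
  exact ⟨k, hk⟩

theorem sameCycle_mul_swap {σ : Perm (Fin n)} {j x y : Fin n} (hx : σ x = x) (hj : j ≠ x) :
    (σ * swap j x).SameCycle j y ↔ σ.SameCycle j y ∨ y = x := by
  constructor
  · intro h
    by_contra! hc
    obtain ⟨k, hk⟩ := exists_pow_of_sameCycle h.symm
    rw [pow_mul_swap_of_not_sameCycle hx hc.2 hc.1] at hk
    exact hc.1 (Perm.SameCycle.symm ⟨k, by simpa using hk⟩)
  · have hjx : (σ * swap j x).SameCycle j x := ⟨1, by simp [hx]⟩
    rintro (h | rfl)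
    · obtain ⟨k, rfl⟩ := exists_pow_of_sameCycle h
      clear h
      induction k with
      | zero => exact Perm.SameCycle.refl _ _
      | succ k ih =>
        rw [pow_succ', Perm.mul_apply]
        by_cases hz : (σ ^ k) j = j
        · rw [hz]
          exact hjx.trans ⟨1, by simp⟩
        · refine ih.trans ⟨1, ?_⟩
          rw [zpow_one, Perm.mul_apply, swap_apply_of_ne_of_ne hz (pow_ne_of_fixed hx hj k)]
    · exact hjx

theorem sameCycle_mul_swap_of_not_sameCycle {σ : Perm (Fin n)} {j x y : Fin n} (hx : σ x = x)
    (hy : y ≠ x) (hj : ¬ σ.SameCycle j y) (z : Fin n) :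
    (σ * swap j x).SameCycle y z ↔ σ.SameCycle y z := by
  constructor <;> intro h <;> obtain ⟨k, hk⟩ := exists_pow_of_sameCycle h
  · rw [pow_mul_swap_of_not_sameCycle hx hy hj] at hk
    exact ⟨k, by simpa using hk⟩
  · rw [← pow_mul_swap_of_not_sameCycle hx hy hj] at hk
    exact ⟨k, by simpa using hk⟩

theorem cycleProd_congr [Ring R] (A : Matrix (Fin n) (Fin n) R) {σ τ : Perm (Fin n)} {y : Fin n}
    (h : ∀ k : ℕ, (σ ^ k) y = (τ ^ k) y) : cycleProd A σ y = cycleProd A τ y := by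
  have hp : Function.minimalPeriod σ y = Function.minimalPeriod τ y := by
    rw [Function.minimalPeriod_eq_minimalPeriod_iff]
    intro k
    simp [Function.IsPeriodicPt, Function.IsFixedPt, Equiv.Perm.iterate_eq_pow, h]
  simp [cycleProd, hp, h]

theorem leadersOff_mul_swap {T : Finset (Fin n)} {σ : Perm (Fin n)} {j x : Fin n}
    (hx : σ x = x) (hj : j ≠ x) :
    leadersOff j T (σ * swap j x) = leadersOff j (T.erase x) σ := by
  unfold leadersOff
  refine List.filter_congr fun y _ => ?_
  simp only [decide_eq_decide, mem_erase, sameCycle_mul_swap hx hj, not_or]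
  by_cases hy : y = x
  · simp [hy]
  by_cases hc : σ.SameCycle j y
  · simp [hc]
  simp [hy, hc, sameCycle_mul_swap_of_not_sameCycle hx hy hc]

theorem pathProd_mul_swap [Ring R] (A : Matrix (Fin n) (Fin n) R) {σ : Perm (Fin n)}
    {j x : Fin n} (a : Fin n) (hx : σ x = x) (hj : j ≠ x) :
    pathProd A a (σ * swap j x) j = A a x * pathProd A x σ j := by
  rw [pathProd, pathProd, minimalPeriod_mul_swap hx hj]
  obtain ⟨p, hp⟩ := Nat.exists_eq_succ_of_ne_zero (minimalPeriod_pos σ j).ne'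
  have h1 : (σ * swap j x) j = x := by simp [hx]
  have h2 : ((σ * swap j x) ^ 2) j = σ j := by simp [pow_succ, hx]
  rw [h1, hp, Nat.add_sub_cancel, List.range_succ_eq_map, List.map_cons, List.prod_cons,
    zero_add, zero_add, pow_one, h1, h2, List.map_map]
  congr 3
  refine List.map_congr_left fun t ht => ?_
  have ht' := List.mem_range.1 ht
  simp only [Function.comp_apply, Nat.succ_eq_add_one]
  rw [show t + 1 + 1 = t + 2 from rfl, show t + 1 + 2 = (t + 1) + 2 from rfl,
    pow_mul_swap hx hj t (by omega), pow_mul_swap hx hj (t + 1) (by omega)]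

theorem term_mul_swap [Ring R] (A : Matrix (Fin n) (Fin n) R) {T : Finset (Fin n)}
    {σ : Perm (Fin n)} {j x : Fin n} (a : Fin n) (hx : σ x = x) (hj : j ≠ x) (hT : x ∈ T) :
    (-1) ^ #T * (pathProd A a (σ * swap j x) j *
      ((leadersOff j T (σ * swap j x)).map fun y => - cycleProd A (σ * swap j x) y).prod) =
    - (A a x * ((-1) ^ #(T.erase x) * (pathProd A x σ j *
      ((leadersOff j (T.erase x) σ).map fun y => - cycleProd A σ y).prod))) := by
  rw [pathProd_mul_swap A a hx hj, leadersOff_mul_swap hx hj, ← card_erase_add_one hT]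
  have : (leadersOff j (T.erase x) σ).map (fun y => - cycleProd A (σ * swap j x) y) =
      (leadersOff j (T.erase x) σ).map fun y => - cycleProd A σ y := by
    refine List.map_congr_left fun y hy => ?_
    simp only [leadersOff, List.mem_filter, mem_erase, decide_eq_true_eq] at hy
    rw [cycleProd_congr A (pow_mul_swap_of_not_sameCycle hx hy.2.1.1 hy.2.2.1)]
  rw [this]
  rcases neg_one_pow_eq_or R #(T.erase x) with h | h <;> simp [pow_succ, h, mul_assoc]

/-- Sort the permutations by σ j. Those fixing j give the first term. Those with σ j = x correspond,
by right multiplication with swap j x, to permutations fixing x; the leading factor A a x splits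
off, and losing one point changes the sign. -/
theorem pathDet_eq [Ring R] (A : Matrix (Fin n) (Fin n) R) {T : Finset (Fin n)} (a : Fin n)
    {j : Fin n} (hj : j ∉ T) :
    pathDet A T a j = A a j * principalDet A T -
      ∑ x ∈ T, A a x * pathDet A (T.erase x) x j := by
  have hmaps : ∀ σ ∈ permsOn (insert j T), σ j ∈ insert j T := by
    intro σ hσ
    by_contra h
    have := σ.injective (mem_permsOn.1 hσ _ h)
    exact h (this.symm ▸ mem_insert_self j T)
  rw [pathDet, ← sum_fiberwise_of_maps_to hmaps, sum_insert hj, sub_eq_add_neg, ← sum_neg_distrib]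
  congr 1
  · rw [principalDet, mul_sum]
    refine sum_congr ?_ ?_
    · ext σ
      simp only [mem_filter, mem_permsOn, mem_insert, not_or]
      constructor
      · rintro ⟨h1, h2⟩ y hy
        by_cases hyj : y = j
        · rw [hyj, h2]
        · exact h1 y ⟨hyj, hy⟩
      · exact fun h => ⟨fun y hy => h y hy.2, h j hj⟩
    · intro σ hσ
      have hσj : σ j = j := mem_permsOn.1 hσ j hj
      have h1 : Function.minimalPeriod σ j = 1 :=
        Function.minimalPeriod_eq_one_iff_isFixedPt.2 hσj
      have h2 : leadersOff j T σ = leaders T σ := by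
        unfold leadersOff leaders
        refine List.filter_congr fun y _ => ?_
        simp only [decide_eq_decide]
        refine and_congr_right fun hy => and_iff_right fun hc => ?_
        obtain ⟨k, hk⟩ := exists_pow_of_sameCycle hc
        rw [Equiv.Perm.pow_apply_eq_self_of_apply_eq_self hσj] at hk
        exact hj (hk ▸ hy)
      rw [h2, pathProd, h1, hσj]
      rcases neg_one_pow_eq_or R #T with h | h <;> simp [h]
  · refine sum_congr rfl fun x hx => ?_
    have hjx : j ≠ x := fun h => hj (h ▸ hx)
    rw [pathDet, mul_sum, ← sum_neg_distrib]
    refine sum_nbij' (fun σ => σ * swap j x) (fun σ => σ * swap j x) ?_ ?_ ?_ ?_ ?_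
    · intro σ hσ
      simp only [mem_filter, mem_permsOn, mem_insert, not_or] at hσ
      simp only [mem_permsOn, mem_insert, mem_erase, not_or]
      rintro y ⟨hyj, hy⟩
      by_cases hyx : y = x
      · simp [hyx, hσ.2]
      · rw [Perm.mul_apply, swap_apply_of_ne_of_ne hyj hyx, hσ.1 y ⟨hyj, fun h => hy ⟨hyx, h⟩⟩]
    · intro σ hσ
      simp only [mem_permsOn, mem_insert, mem_erase, not_or] at hσ
      simp only [mem_filter, mem_permsOn, mem_insert, not_or]
      have hσx : σ x = x := hσ x ⟨hjx.symm, by simp⟩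
      refine ⟨?_, by simp [hσx]⟩
      rintro y ⟨hyj, hy⟩
      have hyx : y ≠ x := fun h => hy (h ▸ hx)
      rw [Perm.mul_apply, swap_apply_of_ne_of_ne hyj hyx, hσ y ⟨hyj, fun h => hy h.2⟩]
    · intro σ _; simp [mul_assoc]
    · intro σ _; simp [mul_assoc]
    · intro σ hσ
      simp only [mem_filter] at hσ
      have h1 : (σ * swap j x) x = x := by simp [hσ.2]
      have h2 := term_mul_swap A a h1 hjx hx
      simpa [mul_assoc] using h2

theorem principalDet_empty [Ring R] (A : Matrix (Fin n) (Fin n) R) : principalDet A ∅ = 1 := by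
  have : permsOn (∅ : Finset (Fin n)) = {1} := by
    ext σ
    simp [mem_permsOn, Equiv.ext_iff]
  simp [principalDet, this, leaders]

/-- The cycle of the minimum m is the leftmost factor, because leaders are listed in increasing
order. For an arbitrary ring only the minimum can be split off in this way. -/
theorem principalDet_eq_pathDet [Ring R] (A : Matrix (Fin n) (Fin n) R) {T : Finset (Fin n)}
    {m : Fin n} (hm : m ∉ T) (hmin : ∀ x ∈ T, m ≤ x) :
    principalDet A (insert m T) = pathDet A T m m := by
  rw [principalDet, pathDet]
  refine sum_congr rfl fun σ hσ => ?_
  have hfix : ∀ y, σ.SameCycle m y → m ≤ y := by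
    intro y hy
    by_cases hyT : y ∈ insert m T
    · rcases mem_insert.1 hyT with h | h
      · exact h.ge
      · exact hmin y h
    · obtain ⟨k, hk⟩ := exists_pow_of_sameCycle hy.symm
      rw [Equiv.Perm.pow_apply_eq_self_of_apply_eq_self (mem_permsOn.1 hσ y hyT)] at hk
      exact hk.ge
  have hl : leaders (insert m T) σ = m :: leadersOff m T σ := by
    have hnot : m ∉ leadersOff m T σ := by simp [leadersOff, hm]
    have hnd : (leadersOff m T σ).Nodup := (List.nodup_finRange n).filter _
    refine List.Perm.eq_of_pairwise (le := (· < ·)) (fun _ _ _ _ h h' => absurd h h'.asymm)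
      ((List.pairwise_lt_finRange n).filter _) ?_ ?_
    · refine List.pairwise_cons.2 ⟨fun y hy => ?_, (List.pairwise_lt_finRange n).filter _⟩
      have hy' : y ∈ T := by
        simp only [leadersOff, List.mem_filter, decide_eq_true_eq] at hy
        exact hy.2.1
      exact lt_of_le_of_ne (hmin y hy') fun h => hm (h ▸ hy')
    · refine (List.perm_ext_iff_of_nodup ((List.nodup_finRange n).filter _)
        (List.nodup_cons.2 ⟨hnot, hnd⟩)).2 fun y => ?_
      simp only [leadersOff, List.mem_filter, List.mem_finRange, true_and,
        decide_eq_true_eq, mem_insert, List.mem_cons]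
      constructor
      · rintro ⟨h1, h2⟩
        by_cases hym : y = m
        · exact Or.inl hym
        · exact Or.inr ⟨h1.resolve_left hym, fun hc =>
            hym (le_antisymm (h2 m hc.symm) (hfix y hc)), h2⟩
      · rintro (rfl | h)
        · exact ⟨Or.inl rfl, hfix⟩
        · exact ⟨Or.inr h.1, h.2.2⟩
  rw [hl, card_insert_of_notMem hm, List.map_cons, List.prod_cons, cycleProd_eq_pathProd]
  rcases neg_one_pow_eq_or R #T with h | h <;> simp [pow_succ, h]

theorem rdet_eq_pathDet [Ring R] (A : Matrix (Fin n) (Fin n) R) (i : Fin n) :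
    rdet i A = pathDet A (univ.erase i) i i := by
  rw [rdet, pathDet]
  have hP : permsOn (insert i (univ.erase i)) = (univ : Finset (Perm (Fin n))) := by
    ext σ; simp [mem_permsOn]
  rw [hP]
  refine sum_congr rfl fun σ _ => ?_
  have hl : leadersOff i (univ.erase i) σ = cycleLeaders σ i := by
    unfold leadersOff cycleLeaders
    refine List.filter_congr fun y _ => ?_
    simp only [decide_eq_decide, mem_erase, mem_univ, and_true]
    refine and_iff_right_of_imp fun h hy => h.1 (hy ▸ Perm.SameCycle.refl _ _)
  rw [hl, cycleProd_eq_pathProd, cycleCount]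
  have hlen : (cycleLeaders σ i).length + 1 ≤ n := by
    have hnot : i ∉ cycleLeaders σ i := by
      simp [cycleLeaders, Perm.SameCycle.refl]
    have hnd : (cycleLeaders σ i).Nodup := (List.nodup_finRange n).filter _
    simpa using (List.nodup_cons.2 ⟨hnot, hnd⟩).length_le_card
  have hneg : ((cycleLeaders σ i).map fun x => - cycleProd A σ x).prod =
      (-1) ^ (cycleLeaders σ i).length * ((cycleLeaders σ i).map (cycleProd A σ)).prod := by
    generalize cycleLeaders σ i = L
    induction L with
    | nil => simp
    | cons x L ih =>
      rw [List.map_cons, List.prod_cons, ih, List.map_cons, List.prod_cons, List.length_cons]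
      rcases neg_one_pow_eq_or R L.length with h | h <;> simp [pow_succ, h]
  -- With r cycles, n - r and (n - 1) + (r - 1) have the same parity: one sign per cycle other than
  -- that of i. The bound `hlen` keeps the natural subtraction from truncating.
  have hs : ((-1 : R)) ^ (n - ((cycleLeaders σ i).length + 1)) =
      (-1) ^ #(univ.erase i) * (-1) ^ (cycleLeaders σ i).length := by
    rw [card_erase_of_mem (mem_univ i), card_univ, Fintype.card_fin, ← pow_add,
      show n - 1 + (cycleLeaders σ i).length =
        (n - ((cycleLeaders σ i).length + 1)) + 2 * (cycleLeaders σ i).length by omega,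
      pow_add, pow_mul]
    simp
  rw [hneg, hs]
  rcases neg_one_pow_eq_or R (cycleLeaders σ i).length with h | h <;> simp [h]

end Permutations

/-! ### Convolution over subsets -/

section SubsetConvolution

variable {R : Type*} [Ring R] {ι : Type*} [DecidableEq ι]

/-- The subset convolution of two functions on finite sets. -/
def conv (f g : Finset ι → R) (T : Finset ι) : R :=
  ∑ U ∈ T.powerset, f U * g (T \ U)

theorem conv_empty (f g : Finset ι → R) : conv f g ∅ = f ∅ * g ∅ := by
  simp [conv]

theorem conv_congr {f f' g g' : Finset ι → R} {T : Finset ι} (hf : ∀ U ⊆ T, f U = f' U)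
    (hg : ∀ U ⊆ T, g U = g' U) : conv f g T = conv f' g' T :=
  sum_congr rfl fun U hU => by rw [hf U (mem_powerset.1 hU), hg _ sdiff_subset]

/-- A Leibniz rule: the new point a goes either to the argument of f or to that of g. The later
inductions on T rest on it. -/
theorem conv_insert (f g : Finset ι → R) {T : Finset ι} {a : ι} (ha : a ∉ T) :
    conv f g (insert a T) =
      conv (fun U => f (insert a U)) g T + conv f (fun U => g (insert a U)) T := by
  rw [conv, sum_powerset_insert ha, add_comm]
  refine congrArg₂ _ (sum_congr rfl fun U hU => ?_) (sum_congr rfl fun U hU => ?_)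
  · rw [insert_sdiff_insert, sdiff_insert_of_notMem ha]
  · rw [insert_sdiff_of_notMem _ fun h => ha (mem_powerset.1 hU h)]

theorem conv_add_left (f f' g : Finset ι → R) (T : Finset ι) :
    conv (fun U => f U + f' U) g T = conv f g T + conv f' g T := by
  simp [conv, add_mul, sum_add_distrib]

theorem conv_add_right (f g g' : Finset ι → R) (T : Finset ι) :
    conv f (fun U => g U + g' U) T = conv f g T + conv f g' T := by
  simp [conv, mul_add, sum_add_distrib]

theorem conv_neg_left (f g : Finset ι → R) (T : Finset ι) :
    conv (fun U => - f U) g T = - conv f g T := by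
  simp [conv]

theorem conv_assoc (f g h : Finset ι → R) (T : Finset ι) :
    conv (conv f g) h T = conv f (conv g h) T := by
  induction T using Finset.induction_on generalizing f g h with
  | empty => simp [conv_empty, mul_assoc]
  | insert a T ha ih =>
    rw [conv_insert _ _ ha, conv_insert _ _ ha, ih,
      conv_congr (f' := fun U => conv (fun V => f (insert a V)) g U +
        conv f (fun V => g (insert a V)) U) (g' := h)
        (fun U hU => conv_insert f g fun h' => ha (hU h')) fun _ _ => rfl,
      conv_congr (f := f) (f' := f) (g' := fun U => conv (fun V => g (insert a V)) h U +
        conv g (fun V => h (insert a V)) U) (fun _ _ => rfl)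
        (fun U hU => conv_insert g h fun h' => ha (hU h')),
      conv_add_left, conv_add_right, ih, ih, add_assoc]

theorem conv_comm {f g : Finset ι → R} (h : ∀ U V, Commute (f U) (g V)) (T : Finset ι) :
    conv f g T = conv g f T := by
  refine sum_nbij' (fun U => T \ U) (fun U => T \ U) ?_ ?_ ?_ ?_ ?_
  · intro U _; simp
  · intro U _; simp
  · intro U hU; simpa using mem_powerset.1 hU
  · intro U hU; simpa using mem_powerset.1 hU
  · intro U hU
    rw [Finset.sdiff_sdiff_eq_self (mem_powerset.1 hU)]
    exact h _ _

end SubsetConvolution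

/-! ### Signed sums over paths -/

section PathSums

variable {R : Type*} [Ring R] {ι : Type*} [DecidableEq ι]

/-- The signed sum, over all orderings `x₁, …, x_r` of the finite set `U`, of the products
`A a x₁ * A x₁ x₂ * ⋯ * A x_r b`; the sign is `(-1) ^ r`. -/
def pathSum (A : Matrix ι ι R) (U : Finset ι) (a b : ι) : R :=
  if U = ∅ then A a b else - ∑ x : U, A a x * pathSum A (U.erase x) x b
termination_by #U
decreasing_by exact card_erase_lt_of_mem x.2

theorem pathSum_empty (A : Matrix ι ι R) (a b : ι) : pathSum A ∅ a b = A a b := by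
  rw [pathSum, if_pos rfl]

theorem pathSum_eq (A : Matrix ι ι R) {U : Finset ι} (hU : U ≠ ∅) (a b : ι) :
    pathSum A U a b = - ∑ x ∈ U, A a x * pathSum A (U.erase x) x b := by
  rw [pathSum, if_neg hU, sum_coe_sort U fun x => A a x * pathSum A (U.erase x) x b]

/-- Splitting off the first step of the path gives the recursion already satisfied by `pathDet`,
whatever g is; this identifies `pathDet` with a convolution. -/
theorem conv_pathSum (A : Matrix ι ι R) (g : Finset ι → R) (T : Finset ι) (a b : ι) :
    conv (fun U => pathSum A U a b) g T =
      A a b * g T - ∑ x ∈ T, A a x * conv (fun U => pathSum A U x b) g (T.erase x) := by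
  have h1 : ∑ x ∈ T, A a x * conv (fun U => pathSum A U x b) g (T.erase x) =
      ∑ x ∈ T, ∑ U ∈ T.powerset with x ∈ U, A a x * pathSum A (U.erase x) x b * g (T \ U) := by
    refine sum_congr rfl fun x hx => ?_
    rw [conv, mul_sum]
    refine sum_nbij' (fun U => insert x U) (fun U => U.erase x) ?_ ?_ ?_ ?_ ?_
    · intro U hU
      simp only [mem_powerset, mem_filter] at hU ⊢
      exact ⟨insert_subset hx (hU.trans (erase_subset _ _)), mem_insert_self _ _⟩
    · intro U hU
      simp only [mem_powerset, mem_filter] at hU ⊢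
      exact erase_subset_erase x hU.1
    · intro U hU
      exact erase_insert fun h => notMem_erase x T (mem_powerset.1 hU h)
    · intro U hU
      exact insert_erase (mem_filter.1 hU).2
    · intro U hU
      have hxU : x ∉ U := fun h => notMem_erase x T (mem_powerset.1 hU h)
      rw [erase_insert hxU, mul_assoc, sdiff_insert, erase_sdiff_comm]
  have h2 : ∑ x ∈ T, ∑ U ∈ T.powerset with x ∈ U,
      A a x * pathSum A (U.erase x) x b * g (T \ U) =
      ∑ U ∈ T.powerset, ∑ x ∈ U, A a x * pathSum A (U.erase x) x b * g (T \ U) := by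
    refine sum_comm' fun x U => ?_
    simp only [mem_filter, mem_powerset]
    exact ⟨fun h => ⟨h.2.2, h.2.1⟩, fun h => ⟨h.2 h.1, h.2, h.1⟩⟩
  rw [h1, h2, conv, ← add_sum_erase _ _ (empty_mem_powerset T),
    ← add_sum_erase _ _ (empty_mem_powerset T), pathSum_empty, sdiff_empty, sum_empty, zero_add,
    sub_eq_add_neg, ← sum_neg_distrib]
  congr 1
  refine sum_congr rfl fun U hU => ?_
  rw [pathSum_eq A (mem_erase.1 hU).1, neg_mul, sum_mul]

theorem pathSum_eq_right (A : Matrix ι ι R) {U : Finset ι} (hU : U ≠ ∅) (a b : ι) :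
    pathSum A U a b = - ∑ x ∈ U, pathSum A (U.erase x) a x * A x b := by
  induction h : #U using Nat.strong_induction_on generalizing U a with
  | _ N ih =>
  subst h
  -- Beyond singletons both ends of the path can be peeled off, and the two double sums agree. For a
  -- singleton the erased set is empty, where the recursion fails.
  by_cases h1 : #U = 1
  · obtain ⟨x, rfl⟩ := card_eq_one.1 h1
    rw [pathSum_eq A hU]
    simp [pathSum_empty]
  have hne : ∀ x ∈ U, U.erase x ≠ ∅ := by
    intro x hx h0
    have := card_erase_add_one hx
    rw [h0] at this
    exact h1 this.symm
  rw [pathSum_eq A hU, neg_inj]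
  have e1 : ∀ x ∈ U, A a x * pathSum A (U.erase x) x b =
      - ∑ y ∈ U.erase x, A a x * pathSum A ((U.erase x).erase y) x y * A y b := by
    intro x hx
    rw [ih _ (card_erase_lt_of_mem hx) (hne x hx) x rfl, mul_neg, mul_sum]
    simp only [mul_assoc]
  have e2 : ∀ y ∈ U, pathSum A (U.erase y) a y * A y b =
      - ∑ x ∈ U.erase y, A a x * pathSum A ((U.erase x).erase y) x y * A y b := by
    intro y hy
    rw [pathSum_eq A (hne y hy), neg_mul, sum_mul]
    simp only [erase_right_comm (a := y)]
  rw [sum_congr rfl e1, sum_congr rfl e2, sum_neg_distrib, sum_neg_distrib]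
  congr 1
  refine sum_comm' fun x y => ?_
  simp only [mem_erase]
  exact ⟨fun h => ⟨⟨h.2.1.symm, h.1⟩, h.2.2⟩, fun h => ⟨h.1.2, h.1.1.symm, h.2⟩⟩

theorem star_pathSum [StarRing R] {A : Matrix ι ι R} (hA : A.IsHermitian) (U : Finset ι)
    (a b : ι) : star (pathSum A U a b) = pathSum A U b a := by
  induction h : #U using Nat.strong_induction_on generalizing U a with
  | _ N ih =>
  subst h
  by_cases hU : U = ∅
  · rw [hU, pathSum_empty, pathSum_empty, hA.apply]
  · rw [pathSum_eq A hU, pathSum_eq_right A hU, star_neg, star_sum, neg_inj]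
    refine sum_congr rfl fun x hx => ?_
    rw [star_mul, ih _ (card_erase_lt_of_mem hx) _ _ rfl, hA.apply]

/-- Each path through k is cut at k into two paths; k itself accounts for the sign. -/
theorem pathSum_insert (A : Matrix ι ι R) {T : Finset ι} {k : ι} (hk : k ∉ T) (a b : ι) :
    pathSum A (insert k T) a b =
      - conv (fun U => pathSum A U a k) (fun U => pathSum A U k b) T := by
  induction h : #T using Nat.strong_induction_on generalizing T a with
  | _ N ih =>
  subst h
  rw [pathSum_eq A (insert_ne_empty k T), sum_insert hk, erase_insert hk, conv_pathSum, neg_inj,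
    sub_eq_add_neg, ← sum_neg_distrib]
  congr 1
  refine sum_congr rfl fun x hx => ?_
  have hkx : k ≠ x := fun h => hk (h ▸ hx)
  rw [erase_insert_of_ne hkx, ih _ (card_erase_lt_of_mem hx)
    (fun h => hk (erase_subset _ _ h)) x rfl, mul_neg]

end PathSums

/-! ### Cofactor expansion of row determinants -/

section Determinants

variable {R : Type*} [Ring R] {n : ℕ}

theorem pathDet_eq_conv (A : Matrix (Fin n) (Fin n) R) {T : Finset (Fin n)} (a : Fin n)
    {j : Fin n} (hj : j ∉ T) :
    pathDet A T a j = conv (fun U => pathSum A U a j) (principalDet A) T := by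
  induction h : #T using Nat.strong_induction_on generalizing T a with
  | _ N ih =>
  subst h
  rw [pathDet_eq A a hj, conv_pathSum]
  congr 1
  refine sum_congr rfl fun x hx => ?_
  rw [ih _ (card_erase_lt_of_mem hx) x (fun h => hj (erase_subset _ _ h)) rfl]

theorem principalDet_insert_of_le (A : Matrix (Fin n) (Fin n) R) {T : Finset (Fin n)}
    {m : Fin n} (hm : m ∉ T) (hmin : ∀ x ∈ T, m ≤ x) :
    principalDet A (insert m T) = conv (fun U => pathSum A U m m) (principalDet A) T := by
  rw [principalDet_eq_pathDet A hm hmin, pathDet_eq_conv A m hm]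

theorem exists_insert_min {T : Finset (Fin n)} (hT : T ≠ ∅) :
    ∃ (m : Fin n) (S : Finset (Fin n)), m ∉ S ∧ (∀ x ∈ S, m ≤ x) ∧ insert m S = T := by
  have hne := nonempty_iff_ne_empty.2 hT
  exact ⟨T.min' hne, T.erase (T.min' hne), notMem_erase _ _,
    fun x hx => T.min'_le x (mem_of_mem_erase hx), insert_erase (T.min'_mem hne)⟩

theorem pathSum_updateRow (A : Matrix (Fin n) (Fin n) R) (j : Fin n) (v : Fin n → R)
    {U : Finset (Fin n)} {a : Fin n} (hU : j ∉ U) (ha : a ≠ j) (b : Fin n) :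
    pathSum (A.updateRow j v) U a b = pathSum A U a b := by
  induction h : #U using Nat.strong_induction_on generalizing U a with
  | _ N ih =>
  subst h
  by_cases hU0 : U = ∅
  · rw [hU0, pathSum_empty, pathSum_empty, Matrix.updateRow_ne ha]
  · rw [pathSum_eq _ hU0, pathSum_eq _ hU0, neg_inj]
    refine sum_congr rfl fun x hx => ?_
    rw [Matrix.updateRow_ne ha, ih _ (card_erase_lt_of_mem hx)
      (fun h => hU (erase_subset _ _ h)) (fun h => hU (h ▸ hx)) rfl]

theorem principalDet_updateRow (A : Matrix (Fin n) (Fin n) R) (j : Fin n) (v : Fin n → R)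
    {T : Finset (Fin n)} (hT : j ∉ T) :
    principalDet (A.updateRow j v) T = principalDet A T := by
  induction h : #T using Nat.strong_induction_on generalizing T with
  | _ N ih =>
  subst h
  by_cases h0 : T = ∅
  · rw [h0, principalDet_empty, principalDet_empty]
  obtain ⟨m, S, hm, hmin, rfl⟩ := exists_insert_min h0
  rw [principalDet_insert_of_le _ hm hmin, principalDet_insert_of_le _ hm hmin]
  refine conv_congr (fun U hU => ?_) fun U hU => ?_
  · exact pathSum_updateRow A j v (fun h => hT (mem_insert_of_mem (hU h)))
      (fun h => hT (h ▸ mem_insert_self _ _)) m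
  · exact ih _ ((card_le_card hU).trans_lt (by simp [hm]))
      (fun h => hT (mem_insert_of_mem (hU h))) rfl

/-- The right cofactors of `A` along its `j`-th row. -/
noncomputable def rowCofactor (A : Matrix (Fin n) (Fin n) R) (j k : Fin n) : R :=
  if k = j then principalDet A (univ.erase j)
  else - conv (fun U => pathSum A U k j) (principalDet A) ((univ.erase j).erase k)

theorem sum_mul_rowCofactor (A : Matrix (Fin n) (Fin n) R) (j : Fin n) (v : Fin n → R) :
    ∑ k, v k * rowCofactor A j k = v j * principalDet A (univ.erase j) -
      ∑ x ∈ univ.erase j, v x * conv (fun U => pathSum A U x j) (principalDet A)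
        ((univ.erase j).erase x) := by
  rw [← add_sum_erase _ _ (mem_univ j), rowCofactor, if_pos rfl, sub_eq_add_neg,
    ← sum_neg_distrib]
  congr 1
  refine sum_congr rfl fun x hx => ?_
  rw [rowCofactor, if_neg (mem_erase.1 hx).1, mul_neg]

theorem sum_row_mul_rowCofactor (A : Matrix (Fin n) (Fin n) R) (l j : Fin n) :
    ∑ k, A l k * rowCofactor A j k =
      conv (fun U => pathSum A U l j) (principalDet A) (univ.erase j) := by
  rw [sum_mul_rowCofactor, conv_pathSum]

/-- Row j is read exactly once, in the leftmost factor; the remaining path sums and principal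
determinants avoid that row. -/
theorem rdet_updateRow (A : Matrix (Fin n) (Fin n) R) (j : Fin n) (v : Fin n → R) :
    rdet j (A.updateRow j v) = ∑ k, v k * rowCofactor A j k := by
  rw [rdet_eq_pathDet, pathDet_eq_conv _ _ (notMem_erase j _), conv_pathSum, sum_mul_rowCofactor,
    Matrix.updateRow_self, principalDet_updateRow _ _ _ (notMem_erase j _)]
  congr 1
  refine sum_congr rfl fun x hx => ?_
  congr 1
  refine conv_congr (fun U hU => ?_) fun U hU => ?_
  · exact pathSum_updateRow A j v (fun h => notMem_erase j _ (erase_subset _ _ (hU h)))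
      (mem_erase.1 hx).1 j
  · exact principalDet_updateRow A j v fun h => notMem_erase j _ (erase_subset _ _ (hU h))

end Determinants

/-! ### Hermitian matrices: adjugate and Cramer's rule -/

section Hermitian

theorem commute_of_star_eq_self {q : ℍ[ℝ]} (hq : star q = q) (r : ℍ[ℝ]) : Commute q r := by
  rw [Quaternion.star_eq_self.1 hq]
  exact Quaternion.coe_commutes _ _

theorem re_mul_comm (p q : ℍ[ℝ]) : (p * q).re = (q * p).re := by
  simp only [Quaternion.re_mul]
  ring

theorem re_sum {α : Type*} (s : Finset α) (f : α → ℍ[ℝ]) : (∑ x ∈ s, f x).re = ∑ x ∈ s, (f x).re :=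
  map_sum (AddMonoidHom.mk' (fun q : ℍ[ℝ] => q.re) fun _ _ => rfl) f s

theorem re_conv_comm {ι : Type*} [DecidableEq ι] (f g : Finset ι → ℍ[ℝ]) (T : Finset ι) :
    (conv f g T).re = (conv g f T).re := by
  simp only [conv, re_sum]
  refine sum_nbij' (fun U => T \ U) (fun U => T \ U) ?_ ?_ ?_ ?_ ?_
  · intro U _; simp
  · intro U _; simp
  · intro U hU; simpa using mem_powerset.1 hU
  · intro U hU; simpa using mem_powerset.1 hU
  · intro U hU
    rw [Finset.sdiff_sdiff_eq_self (mem_powerset.1 hU)]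
    exact re_mul_comm _ _

variable {n : ℕ} {M : Matrix (Fin n) (Fin n) ℍ[ℝ]}

theorem pathSum_self_commute (hM : M.IsHermitian) (U : Finset (Fin n)) (a : Fin n) (q : ℍ[ℝ]) :
    Commute (pathSum M U a a) q :=
  commute_of_star_eq_self (star_pathSum hM U a a) q

/-- Cutting the closed paths at k, or at l, gives the same two families of paths convolved in
opposite orders. Both sums are real, and the real part is insensitive to the order. -/
theorem pathSum_insert_self_comm (hM : M.IsHermitian) {S : Finset (Fin n)} {k l : Fin n}
    (hk : k ∉ S) (hl : l ∉ S) : pathSum M (insert k S) l l = pathSum M (insert l S) k k := by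
  rw [Quaternion.star_eq_self.1 (star_pathSum hM (insert k S) l l),
    Quaternion.star_eq_self.1 (star_pathSum hM (insert l S) k k), pathSum_insert M hk,
    pathSum_insert M hl, Quaternion.re_neg, Quaternion.re_neg, re_conv_comm]

theorem star_principalDet (hM : M.IsHermitian) (T : Finset (Fin n)) :
    star (principalDet M T) = principalDet M T := by
  induction h : #T using Nat.strong_induction_on generalizing T with
  | _ N ih =>
  subst h
  by_cases h0 : T = ∅
  · rw [h0, principalDet_empty, star_one]
  obtain ⟨m, S, hm, hmin, rfl⟩ := exists_insert_min h0
  rw [principalDet_insert_of_le _ hm hmin, conv, star_sum]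
  refine sum_congr rfl fun U hU => ?_
  rw [star_mul, star_pathSum hM, ih _ ((card_le_card sdiff_subset).trans_lt (by simp [hm])) _ rfl]
  exact (pathSum_self_commute hM U m _).symm

/-- The principal determinant of a Hermitian matrix expands along the cycles through any point. -/
theorem principalDet_insert (hM : M.IsHermitian) {S : Finset (Fin n)} {l : Fin n} (hl : l ∉ S) :
    principalDet M (insert l S) = conv (fun U => pathSum M U l l) (principalDet M) S := by
  induction h : #S using Nat.strong_induction_on generalizing S l with
  | _ N ih =>
  subst h
  obtain ⟨m, T, hm, hmin, hT⟩ := exists_insert_min (insert_ne_empty l S)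
  by_cases hml : m = l
  · subst hml
    have : T = S := by rw [← erase_insert hm, hT, erase_insert hl]
    rw [← this]
    exact principalDet_insert_of_le M hm hmin
  have hmS : m ∈ S := (mem_insert.1 (hT ▸ mem_insert_self m T)).resolve_left hml
  obtain ⟨S', hmS', rfl⟩ : ∃ S', m ∉ S' ∧ insert m S' = S :=
    ⟨S.erase m, notMem_erase _ _, insert_erase hmS⟩
  have hlS' : l ∉ S' := fun h => hl (mem_insert_of_mem h)
  have hTe : T = insert l S' := by
    rw [← erase_insert hm, hT, erase_insert_of_ne (Ne.symm hml), erase_insert hmS']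
  subst hTe
  have hsub : ∀ U ⊆ S', principalDet M (insert m U) =
      conv (fun U => pathSum M U m m) (principalDet M) U := fun U hU =>
    principalDet_insert_of_le M (fun h => hmS' (hU h)) fun x hx =>
      hmin x (mem_insert_of_mem (hU hx))
  have hsub' : ∀ U ⊆ S', principalDet M (insert l U) =
      conv (fun U => pathSum M U l l) (principalDet M) U := fun U hU =>
    ih _ ((card_le_card hU).trans_lt (by simp [hmS'])) (fun h => hlS' (hU h)) rfl
  -- Compare the expansions along the minimum m and along l. Terms with m and l in the same cycle
  -- agree by the change of base point; for the others, expand the remaining determinant once more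
  -- and interchange the two central closed sums.
  rw [← hT, principalDet_insert_of_le M hm hmin, conv_insert _ _ hlS', conv_insert _ _ hmS']
  congr 1
  · exact conv_congr (fun U hU =>
      pathSum_insert_self_comm hM (fun h => hlS' (hU h)) fun h => hmS' (hU h)) fun _ _ => rfl
  · rw [conv_congr (fun _ _ => rfl) hsub', conv_congr (fun _ _ => rfl) hsub, ← conv_assoc,
      ← conv_assoc]
    exact conv_congr (fun U _ => conv_comm (fun _ _ => pathSum_self_commute hM _ _ _) U)
      fun _ _ => rfl

/-- The analogue of two equal rows. Either the path from l returns to l, or l lies in the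
determinant part, whose expansion along l supplies the same closed path; the two contributions
cancel. -/
theorem conv_pathSum_principalDet_eq_zero (hM : M.IsHermitian) {T : Finset (Fin n)} {l : Fin n}
    (hl : l ∈ T) (j : Fin n) : conv (fun U => pathSum M U l j) (principalDet M) T = 0 := by
  obtain ⟨S, hlS, rfl⟩ : ∃ S, l ∉ S ∧ insert l S = T := ⟨T.erase l, notMem_erase _ _, insert_erase hl⟩
  rw [conv_insert _ _ hlS,
    conv_congr (f := fun U => pathSum M U l j) (fun _ _ => rfl)
      (fun U hU => principalDet_insert hM fun h => hlS (hU h)),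
    conv_congr (g := principalDet M)
      (fun U hU => pathSum_insert M (fun h => hlS (hU h)) l j) (fun _ _ => rfl),
    conv_neg_left, ← conv_assoc, neg_add_eq_zero]
  exact conv_congr (fun U _ => conv_comm (fun _ _ => pathSum_self_commute hM _ _ _) U)
      fun _ _ => rfl

theorem sum_row_mul_rowCofactor_of_isHermitian (hM : M.IsHermitian) (l j : Fin n) :
    ∑ k, M l k * rowCofactor M j k = if l = j then principalDet M univ else 0 := by
  rw [sum_row_mul_rowCofactor]
  split_ifs with h
  · rw [h, ← principalDet_insert hM (notMem_erase j _), insert_erase (mem_univ j)]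
  · exact conv_pathSum_principalDet_eq_zero hM (mem_erase.2 ⟨h, mem_univ l⟩) j

theorem rdet_eq_principalDet (hM : M.IsHermitian) (j : Fin n) :
    rdet j M = principalDet M univ := by
  have := rdet_updateRow M j (M j)
  rwa [Matrix.updateRow_eq_self, sum_row_mul_rowCofactor_of_isHermitian hM, if_pos rfl] at this

theorem mul_rowCofactor_transpose (hM : M.IsHermitian) :
    M * (Matrix.of (rowCofactor M))ᵀ = Matrix.diagonal fun _ => principalDet M univ := by
  refine Matrix.ext fun l j => ?_
  rw [Matrix.mul_apply, Matrix.diagonal_apply, ← sum_row_mul_rowCofactor_of_isHermitian hM l j]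
  rfl

theorem exists_mul_eq_one (hM : M.IsHermitian) (h : principalDet M univ ≠ 0) :
    ∃ N : Matrix (Fin n) (Fin n) ℍ[ℝ], M * N = 1 := by
  refine ⟨(Matrix.of (rowCofactor M))ᵀ * Matrix.diagonal fun _ => (principalDet M univ)⁻¹, ?_⟩
  rw [← mul_assoc, mul_rowCofactor_transpose hM, Matrix.diagonal_mul_diagonal]
  simp [h]

theorem rdet_updateRow_of_mul_eq_one (hM : M.IsHermitian) {N : Matrix (Fin n) (Fin n) ℍ[ℝ]}
    (hN : M * N = 1) (j : Fin n) (v : Fin n → ℍ[ℝ]) :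
    rdet j (M.updateRow j v) = (v ᵥ* N) j * principalDet M univ := by
  have hR : (Matrix.of (rowCofactor M))ᵀ = N * Matrix.diagonal fun _ => principalDet M univ := by
    rw [← mul_rowCofactor_transpose hM, ← mul_assoc, mul_eq_one_comm.1 hN, one_mul]
  have hR' : ∀ k, rowCofactor M j k = N k j * principalDet M univ := fun k => by
    have := congrFun (congrFun hR k) j
    rwa [Matrix.mul_diagonal] at this
  rw [rdet_updateRow, Matrix.vecMul, dotProduct, sum_mul]
  simp only [hR', mul_assoc]

/-! ### From rows to columns by conjugation -/

theorem minimalPeriod_inv (σ : Perm (Fin n)) (x : Fin n) :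
    Function.minimalPeriod (σ⁻¹ : Perm (Fin n)) x = Function.minimalPeriod σ x := by
  rw [Function.minimalPeriod_eq_minimalPeriod_iff]
  intro k
  simp only [Function.IsPeriodicPt, Function.IsFixedPt, Equiv.Perm.iterate_eq_pow, inv_pow,
    Perm.inv_eq_iff_eq]
  exact eq_comm

theorem star_list_prod (L : List ℍ[ℝ]) : star L.prod = (L.reverse.map star).prod := by
  induction L with
  | nil => simp
  | cons a L ih => simp [ih]

theorem star_cycleProd (A : Matrix (Fin n) (Fin n) ℍ[ℝ]) (σ : Perm (Fin n)) (x : Fin n) :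
    star (cycleProd A σ x) = cycleProd Aᴴ σ⁻¹ x := by
  rw [cycleProd, cycleProd, star_list_prod, minimalPeriod_inv, ← List.map_reverse, List.map_map]
  set p := Function.minimalPeriod σ x with hp
  have hpow : ∀ t ≤ p, ((σ⁻¹ : Perm (Fin n)) ^ t) x = (σ ^ (p - t)) x := by
    intro t ht
    rw [inv_pow, Perm.inv_eq_iff_eq, ← Perm.mul_apply, ← pow_add, Nat.add_sub_cancel' ht,
      ← Equiv.Perm.iterate_eq_pow]
    exact Function.iterate_minimalPeriod.symm
  congr 1
  refine List.ext_getElem (by simp) fun t h1 h2 => ?_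
  have ht : t < p := by simpa using h2
  simp only [List.getElem_map, List.getElem_reverse, List.getElem_range, List.length_range,
    Function.comp_apply, Matrix.conjTranspose_apply]
  rw [hpow t ht.le, hpow (t + 1) ht, show p - 1 - t = p - (t + 1) by omega,
    show p - (t + 1) + 1 = p - t by omega]

theorem cycleLeaders_inv (σ : Perm (Fin n)) (i : Fin n) :
    cycleLeaders σ⁻¹ i = cycleLeaders σ i := by
  simp only [cycleLeaders, Perm.sameCycle_inv]

/-- Conjugation reverses both the order of the cycles and the order inside each one. Passing to σ⁻¹
restores the latter and keeps the leaders. -/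
theorem star_rdet (A : Matrix (Fin n) (Fin n) ℍ[ℝ]) (i : Fin n) :
    star (rdet i A) = cdet i Aᴴ := by
  rw [rdet, cdet, star_sum, ← Equiv.sum_comp (Equiv.inv (Perm (Fin n)))]
  refine sum_congr rfl fun σ _ => ?_
  simp only [Equiv.inv_apply, cycleCount, cycleLeaders_inv]
  rw [star_mul, star_mul, star_cycleProd, inv_inv, star_list_prod, ← List.map_reverse,
    List.map_map]
  have : (star ∘ cycleProd A σ⁻¹) = cycleProd Aᴴ σ := by
    ext1 x
    rw [Function.comp_apply, star_cycleProd, inv_inv]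
  rw [this, star_pow, star_neg, star_one]
  rcases neg_one_pow_eq_or ℍ[ℝ] (n - ((cycleLeaders σ i).length + 1)) with h | h <;> simp [h]

theorem cdet_updateCol_of_mul_eq_one (hM : M.IsHermitian) {N : Matrix (Fin n) (Fin n) ℍ[ℝ]}
    (hN : M * N = 1) (i : Fin n) (c : Fin n → ℍ[ℝ]) :
    cdet i (M.updateCol i c) = principalDet M univ * (N *ᵥ c) i := by
  have hNh : Nᴴ = N := by
    have h1 : Nᴴ * M = 1 := by
      rw [← hM.eq, ← Matrix.conjTranspose_mul, hN, Matrix.conjTranspose_one]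
    rw [← mul_one Nᴴ, ← hN, ← mul_assoc, h1, one_mul]
  have h2 : M.updateCol i c = (M.updateRow i (star c))ᴴ := by
    rw [← Matrix.updateCol_conjTranspose, hM.eq, star_star]
  rw [h2, ← star_rdet, rdet_updateRow_of_mul_eq_one hM hN, star_mul, star_principalDet hM]
  congr 1
  have h3 := congrFun (Matrix.star_vecMul N (star c)) i
  rwa [hNh, star_star] at h3

end Hermitian

/-! ### Real determinant, Schur complements and det(BB*) = det(B*B) -/

section RealDeterminant

variable {n : ℕ}

/-- The representation of the quaternions by real matrices given by left multiplication. -/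
noncomputable def leftRep : ℍ[ℝ] →ₐ[ℝ] Matrix (Fin 4) (Fin 4) ℝ :=
  Algebra.leftMulMatrix (QuaternionAlgebra.basisOneIJK (-1 : ℝ) 0 (-1))

/-- The representation of quaternion matrices by real matrices given by left multiplication. -/
noncomputable def realRep (n : ℕ) :
    Matrix (Fin n) (Fin n) ℍ[ℝ] →+* Matrix (Fin n × Fin 4) (Fin n × Fin 4) ℝ :=
  (Matrix.compRingEquiv (Fin n) (Fin 4) ℝ).toRingHom.comp
    leftRep.toRingHom.mapMatrix

/-- The determinant of the real representation of a quaternion matrix. -/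
noncomputable def realDet (A : Matrix (Fin n) (Fin n) ℍ[ℝ]) : ℝ :=
  (realRep n A).det

theorem realDet_one : realDet (1 : Matrix (Fin n) (Fin n) ℍ[ℝ]) = 1 := by
  rw [realDet, map_one, Matrix.det_one]

theorem realDet_mul (A B : Matrix (Fin n) (Fin n) ℍ[ℝ]) :
    realDet (A * B) = realDet A * realDet B := by
  rw [realDet, map_mul, Matrix.det_mul, realDet, realDet]

theorem realDet_one_add_mul {X Y : Matrix (Fin n) (Fin n) ℍ[ℝ]} (h : X * Y = 0) :
    realDet (1 + Y * X) = 1 := by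
  rw [realDet, map_add, map_one, map_mul, Matrix.det_one_add_mul_comm, ← map_mul, h, map_zero,
    add_zero, Matrix.det_one]

theorem realDet_diagonal (r : Fin n → ℝ) :
    realDet (Matrix.diagonal fun i => (r i : ℍ[ℝ])) = ∏ i, r i ^ 4 := by
  have : realRep n (Matrix.diagonal fun i => (r i : ℍ[ℝ])) =
      Matrix.diagonal fun p => r p.1 := by
    ext ⟨a, s⟩ ⟨b, t⟩
    have hr : ∀ x : ℝ, leftRep (x : ℍ[ℝ]) = algebraMap ℝ _ x := leftRep.commutes
    change (leftRep ((Matrix.diagonal fun i => (r i : ℍ[ℝ])) a b)) s t = _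
    by_cases hab : a = b
    · subst hab
      rw [Matrix.diagonal_apply_eq, hr, Matrix.algebraMap_matrix_apply]
      by_cases hst : s = t
      · subst hst; simp
      · simp [hst]
    · rw [Matrix.diagonal_apply_ne _ hab, map_zero]
      simp [hab]
  rw [realDet, this, Matrix.det_diagonal, Fintype.prod_prod_type]
  simp

theorem realDet_updateCol_one {v : Fin n → ℍ[ℝ]} {l : Fin n} (hv : v l = 1) :
    realDet ((1 : Matrix (Fin n) (Fin n) ℍ[ℝ]).updateCol l v) = 1 ∧
      realDet ((1 : Matrix (Fin n) (Fin n) ℍ[ℝ]).updateCol l v)ᴴ = 1 := by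
  -- The matrix is 1 + N P with P N = 0, as row l of N vanishes when v l = 1. So Sylvester's
  -- identity applies to it and to its adjoint.
  set P : Matrix (Fin n) (Fin n) ℍ[ℝ] := Matrix.diagonal (Pi.single l 1) with hP
  set N : Matrix (Fin n) (Fin n) ℍ[ℝ] := (1 : Matrix (Fin n) (Fin n) ℍ[ℝ]).updateCol l v - 1 with hN
  have hNP : N * P = N := by
    refine Matrix.ext fun a b => ?_
    rw [hP, Matrix.mul_diagonal, hN, Matrix.sub_apply]
    by_cases hb : b = l
    · simp [hb]
    · simp [hb]
  have hPN : P * N = 0 := by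
    refine Matrix.ext fun a b => ?_
    rw [hP, Matrix.diagonal_mul, hN, Matrix.sub_apply]
    by_cases ha : a = l
    · subst ha
      by_cases hb : b = a
      · subst hb; simp [hv]
      · simp [hb]
    · simp [ha]
  have hE : (1 : Matrix (Fin n) (Fin n) ℍ[ℝ]).updateCol l v = 1 + N * P := by
    rw [hNP, hN, add_sub_cancel]
  rw [hE]
  refine ⟨realDet_one_add_mul hPN, ?_⟩
  rw [Matrix.conjTranspose_add, Matrix.conjTranspose_mul, Matrix.conjTranspose_one]
  refine realDet_one_add_mul ?_
  rw [← Matrix.conjTranspose_mul, hPN, Matrix.conjTranspose_zero]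

/-- The matrix that agrees with `M` on `T × T` and with the identity matrix elsewhere. -/
noncomputable def truncate (M : Matrix (Fin n) (Fin n) ℍ[ℝ]) (T : Finset (Fin n)) :
    Matrix (Fin n) (Fin n) ℍ[ℝ] :=
  Matrix.of fun a b => if a ∈ T ∧ b ∈ T then M a b else (1 : Matrix (Fin n) (Fin n) ℍ[ℝ]) a b

theorem truncate_empty (M : Matrix (Fin n) (Fin n) ℍ[ℝ]) : truncate M ∅ = 1 := by
  refine Matrix.ext fun a b => ?_
  simp [truncate]

theorem truncate_univ (M : Matrix (Fin n) (Fin n) ℍ[ℝ]) : truncate M univ = M := by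
  refine Matrix.ext fun a b => ?_
  simp [truncate]

theorem isHermitian_truncate {M : Matrix (Fin n) (Fin n) ℍ[ℝ]} (hM : M.IsHermitian)
    (T : Finset (Fin n)) : (truncate M T).IsHermitian := by
  refine Matrix.ext fun a b => ?_
  have h1 := hM.apply a b
  simp only [Matrix.conjTranspose_apply, truncate, Matrix.of_apply, and_comm (a := b ∈ T)]
  split_ifs
  · exact h1
  · rw [← Matrix.conjTranspose_apply, Matrix.conjTranspose_one]

/-- The solution vector of the Schur complement step. -/
noncomputable def schurVec (M : Matrix (Fin n) (Fin n) ℍ[ℝ]) (T : Finset (Fin n)) (l x : Fin n) :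
    ℍ[ℝ] :=
  if x = l then 1 else if x ∈ T then
    - conv (fun U => pathSum M U x l) (principalDet M) (T.erase x) * (principalDet M T)⁻¹ else 0

theorem sum_mul_schurVec (M : Matrix (Fin n) (Fin n) ℍ[ℝ]) {T : Finset (Fin n)} {l : Fin n}
    (hl : l ∉ T) (f : Fin n → ℍ[ℝ]) :
    ∑ x, f x * schurVec M T l x = f l + ∑ x ∈ T, f x *
      (- conv (fun U => pathSum M U x l) (principalDet M) (T.erase x) * (principalDet M T)⁻¹) := by
  rw [← sum_subset (subset_univ (insert l T)), sum_insert hl, schurVec, if_pos rfl, mul_one]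
  · congr 1
    refine sum_congr rfl fun x hx => ?_
    rw [schurVec, if_neg (fun h : x = l => hl (h ▸ hx)), if_pos hx]
  · intro x _ hx
    rw [mem_insert, not_or] at hx
    rw [schurVec, if_neg hx.1, if_neg hx.2, mul_zero]

theorem mulVec_schurVec {M : Matrix (Fin n) (Fin n) ℍ[ℝ]} {T : Finset (Fin n)} {l : Fin n}
    (hl : l ∉ T) (hD : principalDet M T ≠ 0) (k : Fin n) :
    ∑ x, M k x * schurVec M T l x =
      conv (fun U => pathSum M U k l) (principalDet M) T * (principalDet M T)⁻¹ := by
  rw [sum_mul_schurVec M hl, conv_pathSum, sub_mul, mul_assoc, mul_inv_cancel₀ hD, mul_one,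
    sub_eq_add_neg, sum_mul, ← sum_neg_distrib]
  congr 1
  refine sum_congr rfl fun x _ => ?_
  rw [neg_mul, mul_neg, mul_assoc]

/-- The vector consists of cofactors divided by D(T), so M sends it to zero at T (wrong-row
expansions) and to the Schur complement D(T ∪ {l}) / D(T) at l. -/
theorem mulVec_schurVec_of_isHermitian {M : Matrix (Fin n) (Fin n) ℍ[ℝ]} (hM : M.IsHermitian)
    {T : Finset (Fin n)} {l : Fin n} (hl : l ∉ T) (hD : principalDet M T ≠ 0) {k : Fin n}
    (hk : k ∈ insert l T) :
    ∑ x, M k x * schurVec M T l x =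
      if k = l then principalDet M (insert l T) * (principalDet M T)⁻¹ else 0 := by
  rw [mulVec_schurVec hl hD]
  split_ifs with h
  · rw [h, principalDet_insert hM hl]
  · rw [conv_pathSum_principalDet_eq_zero hM ((mem_insert.1 hk).resolve_left h), zero_mul]

theorem truncate_mulVec_schurVec {M : Matrix (Fin n) (Fin n) ℍ[ℝ]} (hM : M.IsHermitian)
    {T : Finset (Fin n)} {l : Fin n} (hl : l ∉ T) (hD : principalDet M T ≠ 0) (k : Fin n) :
    ∑ x, truncate M (insert l T) k x * schurVec M T l x =
      if k = l then principalDet M (insert l T) * (principalDet M T)⁻¹ else 0 := by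
  by_cases hk : k ∈ insert l T
  · rw [← mulVec_schurVec_of_isHermitian hM hl hD hk]
    refine sum_congr rfl fun x _ => ?_
    by_cases hx : x ∈ insert l T
    · rw [truncate, Matrix.of_apply, if_pos ⟨hk, hx⟩]
    · rw [mem_insert, not_or] at hx
      rw [schurVec, if_neg hx.1, if_neg hx.2, mul_zero, mul_zero]
  · have hk' := hk
    rw [mem_insert, not_or] at hk'
    rw [if_neg hk'.1]
    refine sum_eq_zero fun x _ => ?_
    by_cases hx : k = x
    · rw [← hx, schurVec, if_neg hk'.1, if_neg hk'.2, mul_zero]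
    · rw [truncate, Matrix.of_apply, if_neg (fun h => hk h.1), Matrix.one_apply_ne hx, zero_mul]

/-- One step of block diagonalisation: a congruence of real determinant one decouples l from T,
leaving the Schur complement at l. -/
theorem schur_congruence {M : Matrix (Fin n) (Fin n) ℍ[ℝ]} (hM : M.IsHermitian)
    {T : Finset (Fin n)} {l : Fin n} (hl : l ∉ T) (hD : principalDet M T ≠ 0) :
    ((1 : Matrix (Fin n) (Fin n) ℍ[ℝ]).updateCol l (schurVec M T l))ᴴ * truncate M (insert l T) *
      (1 : Matrix (Fin n) (Fin n) ℍ[ℝ]).updateCol l (schurVec M T l) =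
    truncate M T * Matrix.diagonal fun i => if i = l then
      principalDet M (insert l T) * (principalDet M T)⁻¹ else 1 := by
  set s := principalDet M (insert l T) * (principalDet M T)⁻¹ with hs
  set v := schurVec M T l with hv
  have hvl : v l = 1 := by simp [hv, schurVec]
  have hcol := truncate_mulVec_schurVec hM hl hD
  rw [← hs, ← hv] at hcol
  have hQ : truncate M (insert l T) * (1 : Matrix (Fin n) (Fin n) ℍ[ℝ]).updateCol l v =
      (truncate M (insert l T)).updateCol l fun k => if k = l then s else 0 := by
    refine Matrix.ext fun a b => ?_
    rw [Matrix.mul_apply]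
    by_cases hb : b = l
    · subst hb
      simpa using hcol a
    · simp [Matrix.updateCol_ne hb, Matrix.one_apply]
  rw [mul_assoc, hQ]
  refine Matrix.ext fun a b => ?_
  rw [Matrix.mul_diagonal, Matrix.mul_apply]
  by_cases ha : a = l
  · subst ha
    by_cases hb : b = a
    · subst hb
      simp [hvl, truncate, hl]
    · have h1 := congrArg star (hcol b)
      rw [star_sum, if_neg hb, star_zero] at h1
      simp only [Matrix.conjTranspose_apply, Matrix.updateCol_self, Matrix.updateCol_ne hb,
        if_neg hb, mul_one]
      have h0 : truncate M T a b = 0 := by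
        rw [truncate, Matrix.of_apply, if_neg fun h => hl h.1, Matrix.one_apply_ne (Ne.symm hb)]
      rw [h0, ← h1]
      refine sum_congr rfl fun x _ => ?_
      rw [star_mul, (isHermitian_truncate hM _).apply]
  · have h2 : ∀ x, ((1 : Matrix (Fin n) (Fin n) ℍ[ℝ]).updateCol l v)ᴴ a x =
        (1 : Matrix (Fin n) (Fin n) ℍ[ℝ]) a x := by
      intro x
      rw [Matrix.conjTranspose_apply, Matrix.updateCol_ne ha, ← Matrix.conjTranspose_apply,
        Matrix.conjTranspose_one]
    simp only [h2]
    rw [← Matrix.mul_apply, one_mul]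
    by_cases hb : b = l
    · subst hb
      simp [truncate, ha, hl]
    · simp [truncate, ha, hb]

theorem star_schurVec_mul {M : Matrix (Fin n) (Fin n) ℍ[ℝ]} (hM : M.IsHermitian)
    {T : Finset (Fin n)} {l : Fin n} (hl : l ∉ T) (hD : principalDet M T ≠ 0) :
    star (schurVec M T l) ⬝ᵥ M *ᵥ schurVec M T l =
      principalDet M (insert l T) * (principalDet M T)⁻¹ := by
  rw [dotProduct, ← add_sum_erase _ _ (mem_univ l), sum_eq_zero, add_zero]
  · rw [Matrix.mulVec, dotProduct,
      mulVec_schurVec_of_isHermitian hM hl hD (mem_insert_self l T), if_pos rfl]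
    simp [schurVec]
  · intro x hx
    by_cases hxT : x ∈ T
    · rw [Matrix.mulVec, dotProduct,
        mulVec_schurVec_of_isHermitian hM hl hD (mem_insert_of_mem hxT),
        if_neg (mem_erase.1 hx).1, mul_zero]
    · simp [schurVec, (mem_erase.1 hx).1, hxT]

/-- For a positive definite Hermitian matrix the principal determinants are positive, and their
fourth powers are the real determinants. -/
theorem principalDet_pos {M : Matrix (Fin n) (Fin n) ℍ[ℝ]} (hM : M.IsHermitian)
    (hpos : ∀ v : Fin n → ℍ[ℝ], v ≠ 0 → 0 < (star v ⬝ᵥ M *ᵥ v).re) (T : Finset (Fin n)) :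
    0 < (principalDet M T).re ∧ realDet (truncate M T) = (principalDet M T).re ^ 4 := by
  induction T using Finset.induction_on with
  | empty => simp [principalDet_empty, truncate_empty, realDet_one]
  | insert l T hl ih =>
    obtain ⟨h1, h2⟩ := ih
    have hreal := fun S => Quaternion.star_eq_self.1 (star_principalDet hM S)
    have hD : principalDet M T ≠ 0 := by
      intro h
      rw [h] at h1
      exact lt_irrefl _ h1
    set s : ℝ := (principalDet M (insert l T)).re / (principalDet M T).re with hs
    have hsq : principalDet M (insert l T) * (principalDet M T)⁻¹ = (s : ℍ[ℝ]) := by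
      rw [hreal, hreal T, hs, div_eq_mul_inv, Quaternion.coe_mul, Quaternion.coe_inv]
    -- The Schur complement is the value of the positive form at `schurVec`, which is nonzero since
    -- its entry at l is 1.
    have hspos : 0 < s := by
      have h3 := hpos (schurVec M T l) fun h => by
        have := congrFun h l
        simp [schurVec] at this
      rwa [star_schurVec_mul hM hl hD, hsq, Quaternion.re_coe] at h3
    have hmul : (principalDet M (insert l T)).re = s * (principalDet M T).re := by
      rw [hs, div_mul_cancel₀ _ h1.ne']
    refine ⟨hmul ▸ mul_pos hspos h1, ?_⟩
    have hvl : schurVec M T l l = 1 := by simp [schurVec]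
    have h4 := congrArg realDet (schur_congruence hM hl hD)
    have hdiag : (fun i => if i = l then principalDet M (insert l T) * (principalDet M T)⁻¹
        else 1) = fun i => (((if i = l then s else 1 : ℝ)) : ℍ[ℝ]) := by
      funext i
      split_ifs
      · exact hsq
      · simp
    rw [realDet_mul, realDet_mul, realDet_mul, (realDet_updateCol_one hvl).1,
      (realDet_updateCol_one hvl).2, one_mul, mul_one, hdiag, realDet_diagonal, h2] at h4
    rw [h4, hmul]
    have : ∏ i, (if i = l then s else 1) ^ 4 = s ^ 4 := by
      rw [prod_pow, prod_ite_eq']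
      simp
    rw [this]
    ring

theorem re_star_dotProduct_self_pos {v : Fin n → ℍ[ℝ]} (hv : v ≠ 0) :
    0 < (star v ⬝ᵥ v).re := by
  have h : (star v ⬝ᵥ v).re = ∑ i, Quaternion.normSq (v i) := by
    rw [dotProduct, re_sum]
    refine sum_congr rfl fun i _ => ?_
    rw [Pi.star_apply, Quaternion.star_mul_self, Quaternion.re_coe]
  obtain ⟨i, hi⟩ := Function.ne_iff.1 hv
  rw [h]
  exact sum_pos' (fun i _ => Quaternion.normSq_nonneg) ⟨i, mem_univ i,
    lt_of_le_of_ne Quaternion.normSq_nonneg fun h => hi (Quaternion.normSq_eq_zero.1 h.symm)⟩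

theorem principalDet_conjTranspose_mul_self {B B' : Matrix (Fin n) (Fin n) ℍ[ℝ]}
    (hB : B' * B = 1) : 0 < (principalDet (Bᴴ * B) univ).re ∧
      realDet Bᴴ * realDet B = (principalDet (Bᴴ * B) univ).re ^ 4 := by
  have h := principalDet_pos (Matrix.isHermitian_conjTranspose_mul_self B) (fun v hv => by
    have h1 : B *ᵥ v ≠ 0 := fun h0 => hv (by
      rw [← Matrix.one_mulVec v, ← hB, ← Matrix.mulVec_mulVec, h0, Matrix.mulVec_zero])
    have h2 := re_star_dotProduct_self_pos h1
    rwa [Matrix.star_mulVec, ← Matrix.dotProduct_mulVec, Matrix.mulVec_mulVec] at h2) univ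
  rwa [truncate_univ, realDet_mul] at h

/-- Both determinants are positive, and their fourth powers are the same product of the real
determinants of B and B*. -/
theorem principalDet_mul_conjTranspose_self {B B' : Matrix (Fin n) (Fin n) ℍ[ℝ]}
    (hB : B * B' = 1) : principalDet (B * Bᴴ) univ = principalDet (Bᴴ * B) univ := by
  obtain ⟨h1, h2⟩ := principalDet_conjTranspose_mul_self (mul_eq_one_comm.1 hB)
  have hB' : B'ᴴ * Bᴴ = 1 := by
    rw [← Matrix.conjTranspose_mul, hB, Matrix.conjTranspose_one]
  obtain ⟨h3, h4⟩ := principalDet_conjTranspose_mul_self hB'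
  rw [Matrix.conjTranspose_conjTranspose] at h3 h4
  rw [Quaternion.star_eq_self.1 (star_principalDet (Matrix.isHermitian_conjTranspose_mul_self B) _),
    Quaternion.star_eq_self.1 (star_principalDet (Matrix.isHermitian_mul_conjTranspose_self B) _)]
  congr 1
  refine (pow_left_inj₀ h3.le h1.le (by norm_num : (4 : ℕ) ≠ 0)).1 ?_
  rw [← h2, ← h4, mul_comm]

end RealDeterminant

/-! ### The equation AXB = C -/

theorem ddet_eq_principalDet {n : ℕ} [NeZero n] (A : Matrix (Fin n) (Fin n) ℍ[ℝ]) :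
    ddet A = principalDet (Aᴴ * A) univ :=
  rdet_eq_principalDet (Matrix.isHermitian_conjTranspose_mul_self A) 0

end QuatDet

theorem theorem3p3 (n : ℕ) [NeZero n] (A B C : Matrix (Fin n) (Fin n) ℍ[ℝ])
    (hA : QuatDet.ddet A ≠ 0) (hB : QuatDet.ddet B ≠ 0) :
    (∃! X : Matrix (Fin n) (Fin n) ℍ[ℝ], A * X * B = C) ∧
    ∀ X : Matrix (Fin n) (Fin n) ℍ[ℝ], A * X * B = C → ∀ i j : Fin n,
      X i j = QuatDet.rdet j ((B * Bᴴ).updateRow j (QuatDet.cA A B C i)) /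
          (QuatDet.ddet A * QuatDet.ddet B) ∧
      X i j = QuatDet.cdet i ((Aᴴ * A).updateCol i (QuatDet.cB A B C j)) /
          (QuatDet.ddet A * QuatDet.ddet B) := by
  have hMA := Matrix.isHermitian_conjTranspose_mul_self A
  have hMB := Matrix.isHermitian_mul_conjTranspose_self B
  rw [QuatDet.ddet_eq_principalDet] at hA hB
  obtain ⟨N, hN⟩ := QuatDet.exists_mul_eq_one hMA hA
  obtain ⟨K, hK⟩ :=
    QuatDet.exists_mul_eq_one (Matrix.isHermitian_conjTranspose_mul_self B) hB
  have hN' := mul_eq_one_comm.1 hN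
  have hA' : (N * Aᴴ) * A = 1 := by rw [mul_assoc, hN']
  have hA'' := mul_eq_one_comm.1 hA'
  have hB' : (K * Bᴴ) * B = 1 := by rw [mul_assoc, mul_eq_one_comm.1 hK]
  have hB'' := mul_eq_one_comm.1 hB'
  obtain ⟨P, hP⟩ : ∃ P, (B * Bᴴ) * P = 1 := by
    -- K B* is B⁻¹, so the candidate is (B⁻¹)* B⁻¹.
    have : (B * Bᴴ) * ((K * Bᴴ)ᴴ * (K * Bᴴ)) = 1 := by
      rw [mul_assoc, ← mul_assoc Bᴴ, ← Matrix.conjTranspose_mul, hB', Matrix.conjTranspose_one,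
        one_mul, hB'']
    exact ⟨_, this⟩
  have hdet := QuatDet.principalDet_mul_conjTranspose_self hB''
  set dA := QuatDet.principalDet (Aᴴ * A) Finset.univ with hdA
  set dB := QuatDet.principalDet (Bᴴ * B) Finset.univ with hdB
  have hcA : ∀ q, Commute dA q :=
    QuatDet.commute_of_star_eq_self (QuatDet.star_principalDet hMA _)
  refine ⟨⟨N * Aᴴ * C * (K * Bᴴ), ?_, fun Y hY => ?_⟩, fun X hX i j => ?_⟩
  · simp only
    rw [← mul_assoc A, ← mul_assoc A, hA'', one_mul, mul_assoc, hB', mul_one]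
  · rw [← hY, mul_assoc A, ← mul_assoc (N * Aᴴ), hA', one_mul, mul_assoc Y, hB'', mul_one]
  -- From C̃ = (A*A) X (BB*). The two formulas bracket N C̃ P from the left or from the right; dA,
  -- being real, is moved freely.
  · have hX' : X = N * QuatDet.cTilde A B C * P := by
      rw [QuatDet.cTilde, ← hX]
      calc X = 1 * X * 1 := by rw [one_mul, mul_one]
        _ = N * (Aᴴ * A) * X * ((B * Bᴴ) * P) := by rw [hN', hP]
        _ = _ := by simp only [mul_assoc]
    have hXr : X = N * (QuatDet.cTilde A B C * P) := by rw [hX', mul_assoc]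
    rw [QuatDet.ddet_eq_principalDet, QuatDet.ddet_eq_principalDet, ← hdA, ← hdB,
      eq_div_iff (mul_ne_zero hA hB), eq_div_iff (mul_ne_zero hA hB)]
    constructor
    · have h1 : QuatDet.cA A B C i = fun m => dA * (N * QuatDet.cTilde A B C) i m := by
        funext m
        rw [QuatDet.cA, QuatDet.cdet_updateCol_of_mul_eq_one hMA hN]
        rfl
      rw [h1, QuatDet.rdet_updateRow_of_mul_eq_one hMB hP, hdet, hX']
      have h2 : ((fun m => dA * (N * QuatDet.cTilde A B C) i m) ᵥ* P) j =
          dA * (N * QuatDet.cTilde A B C * P) i j := by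
        rw [Matrix.vecMul, dotProduct, Matrix.mul_apply, Finset.mul_sum]
        simp only [mul_assoc]
      rw [h2, ← mul_assoc, (hcA _).eq]
    · have h1 : QuatDet.cB A B C j = fun k => (QuatDet.cTilde A B C * P) k j * dB := by
        funext k
        rw [QuatDet.cB, QuatDet.rdet_updateRow_of_mul_eq_one hMB hP, hdet]
        rfl
      rw [h1, QuatDet.cdet_updateCol_of_mul_eq_one hMA hN, hXr]
      have h2 : (N *ᵥ fun k => (QuatDet.cTilde A B C * P) k j * dB) i =
          (N * (QuatDet.cTilde A B C * P)) i j * dB := by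
        rw [Matrix.mulVec, dotProduct, Matrix.mul_apply, Finset.sum_mul]
        simp only [mul_assoc]
      rw [h2, (hcA dB).eq, (hcA (_ * dB)).eq, mul_assoc]
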